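/- For integers $k_1\ge 2$, $k_2,\dots,k_r\ge 1$ let $$\zeta(k_1,\dots,k_r)=\sum_{m_1>m_2>\cdots>m_r>0}\frac{1}{m_1^{k_1}m_2^{k_2}\cdots m_r^{k_r}}$$ be the multiple zeta value (sum over integers $m_i$), with $\zeta(\varnothing)=1$ for the empty index, and write $\{a_i,b_i\}_{i=1}^n$ for the index $(a_1,b_1,a_2,b_2,\dots,a_n,b_n)$. Then for every integer $n\ge 0$ all multiple zeta series below converge, and $$\sum_{\substack{\varepsilon_1,\dots,\varepsilon_n\in\{0,1\}\\ \varepsilon'_1,\dots,\varepsilon'_{n-1}\in\{0,1\}}}\frac{12^n}{2^{\varepsilon_1+\cdots+\varepsilon_n+\varepsilon'_1+\cdots+\varepsilon'_{n-1}}}\,\zeta\bigl(\{5-\varepsilon'_{i-1}-\varepsilon_i,\;1+\varepsilon_i+\varepsilon'_i\}_{i=1}^n\bigr)=\frac{6(2\pi)^{6n}}{(6n+3)!},$$ where $\varepsilon'_0=\varepsilon'_n=0$. -/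

import Mathlib

open scoped Nat

noncomputable section

/-- The summation range of a multiple zeta value of depth `r`: all tuples of natural numbers
`m₁ > m₂ > ⋯ > m_r > 0`. -/
def MZVRange (r : ℕ) : Type :=
  {m : Fin r → ℕ // StrictAnti m ∧ ∀ i, 0 < m i}

/-- The summand `1 / (m₁ ^ k₁ ⋯ m_r ^ k_r)` of the series for `ζ(k₁, …, k_r)`. -/
def mzvTerm (k : List ℕ) (m : MZVRange k.length) : ℝ :=
  ∏ i : Fin k.length, 1 / ((m.1 i : ℕ) : ℝ) ^ (k.get i)

/-- The series defining `ζ(k₁, …, k_r)` converges (all its terms are nonnegative). -/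
def MZVConverges (k : List ℕ) : Prop :=
  Summable (mzvTerm k)

/-- The multiple zeta value
`ζ(k₁, …, k_r) = ∑_{m₁ > ⋯ > m_r > 0} 1 / (m₁ ^ k₁ ⋯ m_r ^ k_r)`.
For the empty list the sum has the empty tuple as its only index, and the value is `1`. -/
def mzv (k : List ℕ) : ℝ :=
  ∑' m : MZVRange k.length, mzvTerm k m

/-- The sequence `ε'₀, ε'₁, …, ε'ₙ` obtained from `ε'₁, …, ε'ₙ₋₁` (the values of `ε'` at
`0, …, n - 2`) by setting `ε'₀ = ε'ₙ = 0`. -/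
def extendZero {n : ℕ} (ε' : Fin (n - 1) → Fin 2) (j : ℕ) : ℕ :=
  if h : 1 ≤ j ∧ j < n then (ε' ⟨j - 1, by omega⟩ : ℕ) else 0

/-- The index `{5 - ε'_{i-1} - ε_i, 1 + ε_i + ε'_i}_{i=1}^n` of depth `2n`, that is, the
concatenation of the pairs for `i = 1, …, n`. The element `i : Fin n` of value `i` stands for the
position `i + 1`. The subtraction is never truncated, as the `ε`s are at most `1`. -/
def kIndex {n : ℕ} (ε : Fin n → Fin 2) (ε' : Fin (n - 1) → Fin 2) : List ℕ :=
  (List.ofFn fun i : Fin n =>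
    [5 - extendZero ε' (i : ℕ) - (ε i : ℕ),
      1 + (ε i : ℕ) + extendZero ε' ((i : ℕ) + 1)]).flatten

end

/-!
The weighted sum on the left is `ζ({6}^n)` in disguise, and the identity comes from the
factorisation `1 - t² / m⁶ = (1 + t / m³) (1 - t / m³)`: comparing the coefficients of `t ^ (2 n)`
in the products over all `m` gives
`(-1)^n ζ({6}^n) = ∑_{a + b = 2 n} (-1)^b ζ({3}^a) ζ({3}^b)`.

The products on the right are expanded by shuffling. Write a multiple polylogarithm as a word in
the integrations `x : ∫ dz / z` and `y : ∫ dz / (1 - z)`, so that `{3}^a` is `(xxy)^a`. Put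
`f = ∑ t ^ a Li_{(xxy)^a}(z)`, which solves `θ³ f = t z / (1 - z) f` for `θ = z d/dz`, and let
`g` be the same series for `-t`. Differentiating `f g` and the products `θⁱ f · θʲ g` closes up
after six steps, because half of the terms cancel between `t` and `-t`. In integrated form
(`tCoeff_eulerDeriv_shuffle_add_two`) this says that `A = θ (f g)` satisfies
`A = -12 t² · xx (xy + yx / 2) (y (f g) + xy A / 2)`, while `f g = 1 + x A`. Expanding the
brackets, the choices in the first one are the `ε_i`, those in the second one the `ε'_i`, and each
choice of the second summand costs a factor `1 / 2`: this is exactly the sum in the theorem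
(`blockSum_zero_eq`).

All of this is an identity of formal power series in `z`. Its value at `z = 1` is the sum of the
coefficients, which is multiplicative by Cauchy's theorem on products of absolutely convergent
series (`hasSum_tCoeff_shuffle`), and `mzvCoeff` identifies the coefficient sums with multiple zeta
values. As every coefficient is nonnegative and every weight positive, convergence of each of the
multiple zeta series follows from that of the weighted sum.

Finally `ζ({6}^n) = 6 (2π)^(6n) / (6n + 3)!` (`eulerCoeff_six`): by Euler's product,
`∏ (1 - z⁶ / m⁶)` is the product of the three functions `sin (π ωʲ z) / (π ωʲ z)`, `ω³ = 1`. Since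
the arguments sum to `0`, the product of the sines is `-1/4` times the sum of the
`sin (2 π ωʲ z)`, whose power series is explicit.
-/

/-! ### Multiple zeta values as sums of polylogarithm coefficients -/

/-- The coefficient of `z ^ N` in the multiple polylogarithm
`∑ z ^ m₁ / (m₁ ^ k₁ ⋯ m_r ^ k_r)`: the part of the series for `ζ(k)` with `m₁ = N`.
The empty tuple is assigned to `N = 0`. -/
noncomputable def mzvCoeff : List ℕ → ℕ → ℝ
  | [], N => if N = 0 then 1 else 0
  | k :: ks, N => 1 / (N : ℝ) ^ k * ∑ M ∈ Finset.range N, mzvCoeff ks M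

/-- The largest entry `m₁` of a tuple `m₁ > ⋯ > m_r > 0`, or `0` for the empty tuple. -/
def MZVRange.head : {r : ℕ} → MZVRange r → ℕ
  | 0, _ => 0
  | _ + 1, m => m.1 0

theorem MZVRange.lt_of_head_lt {r : ℕ} (m : MZVRange r) {N : ℕ} (h : m.head < N) (i : Fin r) :
    m.1 i < N := by
  cases r with
  | zero => exact i.elim0
  | succ r => exact (m.2.1.antitone (Fin.zero_le i)).trans_lt h

/-- A tuple with largest entry `N` is `N` followed by a tuple with smaller largest entry. -/
def MZVRange.headEquiv (r N : ℕ) :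
    {m : MZVRange (r + 1) | m.head = N} ≃ {m : MZVRange r | m.head < N} where
  toFun m := ⟨⟨Fin.tail m.1.1, fun _ _ h => m.1.2.1 (Fin.succ_lt_succ_iff.2 h),
      fun i => m.1.2.2 i.succ⟩, by
    obtain ⟨⟨m, hm, hpos⟩, h⟩ := m
    change m 0 = N at h
    cases r with
    | zero => exact h ▸ hpos 0
    | succ r => exact h ▸ hm (Fin.succ_pos 0)⟩
  invFun m := ⟨⟨Fin.cons N m.1.1, by
      intro i j hij
      cases j using Fin.cases with
      | zero => exact absurd hij (Fin.not_lt_zero i)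
      | succ j =>
        cases i using Fin.cases with
        | zero => simpa using m.1.lt_of_head_lt m.2 j
        | succ i => simpa using m.1.2.1 (Fin.succ_lt_succ_iff.1 hij), by
      intro i
      cases i using Fin.cases with
      | zero => exact (Nat.zero_le _).trans_lt m.2
      | succ i => simpa using m.1.2.2 i⟩, rfl⟩
  left_inv m := by
    obtain ⟨⟨m, hm, hpos⟩, h⟩ := m
    change m 0 = N at h
    subst h
    exact Subtype.ext (Subtype.ext (Fin.cons_self_tail m))
  right_inv m := rfl

theorem mzvTerm_nonneg (k : List ℕ) (m : MZVRange k.length) : 0 ≤ mzvTerm k m :=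
  Finset.prod_nonneg fun _ _ => by positivity

theorem mzvCoeff_nonneg (k : List ℕ) (N : ℕ) : 0 ≤ mzvCoeff k N := by
  induction k generalizing N with
  | nil => unfold mzvCoeff; split_ifs <;> norm_num
  | cons k ks ih =>
    unfold mzvCoeff
    exact mul_nonneg (by positivity) (Finset.sum_nonneg fun M _ => ih M)

theorem hasSum_mzvTerm_head_eq (k : List ℕ) (N : ℕ) :
    HasSum (fun m : {m : MZVRange k.length | m.head = N} => mzvTerm k m) (mzvCoeff k N) := by
  induction k generalizing N with
  | nil =>
    have hu : ∀ m m' : MZVRange ([] : List ℕ).length, m = m' := fun m m' =>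
      Subtype.ext (funext fun i => i.elim0)
    by_cases hN : N = 0
    · subst hN
      let m₀ : {m : MZVRange ([] : List ℕ).length | m.head = 0} :=
        ⟨⟨fun i => i.elim0, fun i => i.elim0, fun i => i.elim0⟩, rfl⟩
      convert hasSum_single (f := fun m : {m : MZVRange ([] : List ℕ).length | m.head = 0} =>
        mzvTerm [] m) m₀ (fun m hm => absurd (Subtype.ext (hu _ _)) hm) using 1
      simp [mzvCoeff, mzvTerm]
    · have : IsEmpty {m : MZVRange ([] : List ℕ).length | m.head = N} :=
        ⟨fun m => hN m.2.symm⟩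
      simp [mzvCoeff, hN]
  | cons k ks ih =>
    have h1 : HasSum (mzvTerm ks ∘ (↑) : {m : MZVRange ks.length | m.head < N} → ℝ)
        (∑ M ∈ Finset.range N, mzvCoeff ks M) := by
      have h := hasSum_sum_disjoint (f := mzvTerm ks) (s := Finset.range N)
        (t := fun M => {m : MZVRange ks.length | m.head = M}) (a := mzvCoeff ks)
        (fun M _ M' _ hMM' => Set.disjoint_left.2 fun m h h' => hMM' (h.symm.trans h'))
        (fun M _ => ih M)
      have hset : (⋃ M ∈ Finset.range N, {m : MZVRange ks.length | m.head = M}) =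
          {m : MZVRange ks.length | m.head < N} := by ext m; simp
      rwa [hset] at h
    refine (MZVRange.headEquiv ks.length N).symm.hasSum_iff.1 ?_
    have h2 := h1.mul_left (1 / (N : ℝ) ^ k)
    refine (congrArg (HasSum · _) (funext fun m => ?_)).mpr h2
    exact Fin.prod_univ_succ (fun i : Fin (ks.length + 1) =>
      1 / ((((MZVRange.headEquiv ks.length N).symm m).1.1 i : ℕ) : ℝ) ^ (k :: ks).get i)

theorem hasSum_mzvTerm_iff (k : List ℕ) (a : ℝ) :
    HasSum (mzvTerm k) a ↔ HasSum (mzvCoeff k) a := by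
  let e := Equiv.sigmaFiberEquiv (MZVRange.head (r := k.length))
  have key : Summable (mzvCoeff k) → Summable (mzvTerm k) := by
    intro h
    rw [← e.summable_iff]
    refine (summable_sigma_of_nonneg fun x => mzvTerm_nonneg k _).2
      ⟨fun N => (hasSum_mzvTerm_head_eq k N).summable, ?_⟩
    exact h.congr fun N => ((hasSum_mzvTerm_head_eq k N).tsum_eq).symm
  have key' : ∀ a, HasSum (mzvTerm k) a → HasSum (mzvCoeff k) a := fun a h =>
    ((e.hasSum_iff).2 h).sigma fun N => hasSum_mzvTerm_head_eq k N
  refine ⟨key' a, fun h => ?_⟩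
  have h2 := (key h.summable).hasSum
  rwa [(key' _ h2).unique h] at h2

/-! ### Integration operators -/

/-- The operator `f ↦ ∫ f dz / z` on the coefficient sequences of power series in `z`. -/
noncomputable def polyX : (ℕ → ℝ) →ₗ[ℝ] (ℕ → ℝ) where
  toFun f N := (N : ℝ)⁻¹ * f N
  map_add' f g := by ext N; simp [mul_add]
  map_smul' c f := by ext N; simp [mul_left_comm]

/-- The operator `f ↦ ∫ f dz / (1 - z)` on the coefficient sequences of power series in `z`. -/
noncomputable def polyY : (ℕ → ℝ) →ₗ[ℝ] (ℕ → ℝ) where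
  toFun f N := (N : ℝ)⁻¹ * ∑ M ∈ Finset.range N, f M
  map_add' f g := by ext N; simp [mul_add, Finset.sum_add_distrib]
  map_smul' c f := by ext N; simp [mul_left_comm, Finset.mul_sum]

theorem iterate_polyX_apply (k : ℕ) (f : ℕ → ℝ) (N : ℕ) :
    (polyX^[k] f) N = ((N : ℝ) ^ k)⁻¹ * f N := by
  induction k with
  | zero => simp
  | succ k ih =>
    rw [Function.iterate_succ_apply']
    change (N : ℝ)⁻¹ * (polyX^[k] f) N = _
    rw [ih, pow_succ, mul_inv, ← mul_assoc, mul_comm (N : ℝ)⁻¹]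

theorem mzvCoeff_cons (k : ℕ) (ks : List ℕ) :
    mzvCoeff ((k + 1) :: ks) = polyX^[k] (polyY (mzvCoeff ks)) := by
  ext N
  rw [iterate_polyX_apply, mzvCoeff]
  change _ = _ * ((N : ℝ)⁻¹ * _)
  rw [one_div, pow_succ, mul_inv, mul_assoc]

/-! ### The shuffle identity -/

section Shuffle

open PowerSeries

/-- The Euler derivation `θ = z d/dz` on power series in `z`. -/
noncomputable def eulerDeriv {R : Type*} [CommRing R] (f : R⟦X⟧) : R⟦X⟧ :=
  X * derivative R f

section
variable {R : Type*} [CommRing R]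

theorem coeff_eulerDeriv (f : R⟦X⟧) (N : ℕ) : coeff N (eulerDeriv f) = N * coeff N f := by
  cases N with
  | zero => simp [eulerDeriv]
  | succ N => simp [eulerDeriv, coeff_succ_X_mul, coeff_derivative, mul_comm]

theorem eulerDeriv_add (f g : R⟦X⟧) : eulerDeriv (f + g) = eulerDeriv f + eulerDeriv g := by
  simp [eulerDeriv, mul_add]

theorem eulerDeriv_sub (f g : R⟦X⟧) : eulerDeriv (f - g) = eulerDeriv f - eulerDeriv g := by
  simp [eulerDeriv, mul_sub]

theorem eulerDeriv_mul (f g : R⟦X⟧) :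
    eulerDeriv (f * g) = eulerDeriv f * g + f * eulerDeriv g := by
  simp only [eulerDeriv, Derivation.leibniz, smul_eq_mul]
  ring

theorem constantCoeff_eulerDeriv (f : R⟦X⟧) : constantCoeff (eulerDeriv f) = 0 := by
  simp [eulerDeriv]

/-- The power series `z / (1 - z) = z + z ^ 2 + ⋯`; multiplication by it takes partial sums of
the coefficients. -/
noncomputable def geomTail (R : Type*) [CommRing R] : R⟦X⟧ :=
  X * mk 1

theorem coeff_geomTail_mul (f : R⟦X⟧) (N : ℕ) :
    coeff N (geomTail R * f) = ∑ M ∈ Finset.range N, coeff M f := by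
  rw [geomTail, mul_assoc]
  cases N with
  | zero => simp
  | succ N =>
    rw [coeff_succ_X_mul, mul_comm, coeff_mul,
      Finset.Nat.sum_antidiagonal_eq_sum_range_succ_mk]
    simp

end

/-- For a power series `f` in `z` with coefficients in `ℝ[t]`, the coefficient sequence of the
power series in `z` that multiplies `t ^ k`. -/
noncomputable def tCoeff (k : ℕ) : (Polynomial ℝ)⟦X⟧ →ₗ[ℝ] (ℕ → ℝ) where
  toFun f N := (coeff N f).coeff k
  map_add' f g := by ext N; simp
  map_smul' c f := by ext N; simp

theorem tCoeff_zero_X_mul (f : (Polynomial ℝ)⟦X⟧) : tCoeff 0 (C Polynomial.X * f) = 0 := by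
  ext N; simp [tCoeff, coeff_C_mul]

theorem tCoeff_succ_X_mul (k : ℕ) (f : (Polynomial ℝ)⟦X⟧) :
    tCoeff (k + 1) (C Polynomial.X * f) = tCoeff k f := by
  ext N; simp [tCoeff, coeff_C_mul, Polynomial.coeff_X_mul]

/-- Integration of a differential equation `θ f = h + z / (1 - z) h'`. -/
theorem tCoeff_eq_of_eulerDeriv {f h h' : (Polynomial ℝ)⟦X⟧} (hf : constantCoeff f = 0)
    (hd : eulerDeriv f = h + geomTail _ * h') (k : ℕ) :
    tCoeff k f = polyX (tCoeff k h) + polyY (tCoeff k h') := by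
  ext N
  change (coeff N f).coeff k = (N : ℝ)⁻¹ * (coeff N h).coeff k +
    (N : ℝ)⁻¹ * ∑ M ∈ Finset.range N, (coeff M h').coeff k
  rcases eq_or_ne N 0 with rfl | hN
  · simp [coeff_zero_eq_constantCoeff_apply, hf]
  · have hN' : (N : ℝ) ≠ 0 := Nat.cast_ne_zero.2 hN
    have h1 := congrArg (fun p => Polynomial.coeff p k) (congrArg (coeff N) hd)
    simp only [coeff_eulerDeriv, map_add, coeff_geomTail_mul, Polynomial.coeff_add,
      Polynomial.finsetSum_coeff, Polynomial.coeff_natCast_mul] at h1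
    rw [← mul_add, ← h1, inv_mul_cancel_left₀ hN']

/-- The finite product `∏_{m = 1}^{M} (1 + t / m ^ s)`. -/
noncomputable def eulerPoly (s : ℕ) (t : Polynomial ℝ) (M : ℕ) : Polynomial ℝ :=
  ∏ m ∈ Finset.range M, (1 + Polynomial.C (((m : ℝ) + 1) ^ s)⁻¹ * t)

/-- The generating series `∑_a t ^ a ∑_{m₁ > ⋯ > m_a > 0} z ^ m₁ / (m₁ ⋯ m_a) ^ 3` of the
polylogarithms of index `{3}^a`. -/
noncomputable def threeSeries (t : Polynomial ℝ) : (Polynomial ℝ)⟦X⟧ :=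
  mk fun N => if N = 0 then 1 else eulerPoly 3 t N - eulerPoly 3 t (N - 1)

theorem sum_coeff_threeSeries (t : Polynomial ℝ) (M : ℕ) :
    ∑ N ∈ Finset.range (M + 1), coeff N (threeSeries t) = eulerPoly 3 t M := by
  rw [Finset.sum_range_succ']
  simp only [threeSeries, coeff_mk, Nat.add_eq_zero_iff, one_ne_zero, and_false, if_false,
    add_tsub_cancel_right, if_true]
  rw [Finset.sum_range_sub]
  simp [eulerPoly]

theorem eulerDeriv_threeSeries (t : Polynomial ℝ) :
    eulerDeriv (eulerDeriv (eulerDeriv (threeSeries t))) =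
      geomTail _ * (C t * threeSeries t) := by
  ext1 N
  rw [coeff_geomTail_mul]
  simp only [coeff_eulerDeriv, coeff_C_mul]
  rw [← Finset.mul_sum]
  cases N with
  | zero => simp
  | succ N =>
    rw [sum_coeff_threeSeries]
    simp only [threeSeries, coeff_mk, Nat.add_eq_zero_iff, one_ne_zero, and_false, if_false,
      add_tsub_cancel_right]
    rw [eulerPoly, Finset.prod_range_succ, ← eulerPoly]
    have h : ((N + 1 : ℕ) : Polynomial ℝ) ^ 3 * Polynomial.C (((N : ℝ) + 1) ^ 3)⁻¹ = 1 := by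
      rw [← Polynomial.C_eq_natCast, ← Polynomial.C_pow, ← Polynomial.C_mul, ← Polynomial.C_1]
      congr 1
      push_cast
      exact mul_inv_cancel₀ (by positivity)
    linear_combination (eulerPoly 3 t N * t) * h

theorem constantCoeff_threeSeries (t : Polynomial ℝ) : constantCoeff (threeSeries t) = 1 := by
  rw [← coeff_zero_eq_constantCoeff_apply]; simp [threeSeries]

/-- The product of the generating series for `t` and `-t`; the coefficient of `t ^ (2 n)` is the
alternating sum of the products of the polylogarithms of index `{3}^a` and `{3}^b`, `a + b = 2n`. -/
noncomputable def shuffleSeries : (Polynomial ℝ)⟦X⟧ :=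
  threeSeries Polynomial.X * threeSeries (-Polynomial.X)

/-- The combination `θ² f · g - f · θ² g` of the factors `f`, `g` of the shuffle product. It is
reached half-way through each block, after the bracket that carries `ε_i`. -/
noncomputable def antiSeries : (Polynomial ℝ)⟦X⟧ :=
  eulerDeriv (eulerDeriv (threeSeries Polynomial.X)) * threeSeries (-Polynomial.X) -
    threeSeries Polynomial.X * eulerDeriv (eulerDeriv (threeSeries (-Polynomial.X)))

/-- The differential equations of the combinations of the products `θⁱ f · θʲ g`, `i, j ≤ 2`, that
occur in the iterated derivatives of `f g`, in integrated form. Every integration of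
`dz / (1 - z)` comes with a factor `t`. -/
theorem tCoeff_shuffle (k : ℕ) :
    tCoeff k (shuffleSeries - 1) = polyX (tCoeff k (eulerDeriv shuffleSeries)) ∧
    tCoeff k antiSeries =
      polyX (polyY (tCoeff k (C Polynomial.X * eulerDeriv shuffleSeries))) +
        (2 : ℝ) • polyY (tCoeff k (C Polynomial.X * shuffleSeries)) ∧
    ∃ d, eulerDeriv d = antiSeries ∧ constantCoeff d = 0 ∧
      tCoeff k (eulerDeriv shuffleSeries) = (-3 : ℝ) • polyX (polyX
        ((2 : ℝ) • polyX (polyY (tCoeff k (C Polynomial.X * antiSeries))) +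
          polyY (tCoeff k (C Polynomial.X * d)))) := by
  unfold antiSeries shuffleSeries
  have hf₃ := eulerDeriv_threeSeries Polynomial.X
  have hg₃ := eulerDeriv_threeSeries (-Polynomial.X)
  rw [map_neg] at hg₃
  have cf := constantCoeff_threeSeries Polynomial.X
  have cg := constantCoeff_threeSeries (-Polynomial.X)
  generalize threeSeries Polynomial.X = f at *
  generalize threeSeries (-Polynomial.X) = g at *
  have cf₁ := constantCoeff_eulerDeriv f
  have cg₁ := constantCoeff_eulerDeriv g
  have hA : eulerDeriv (f * g) = eulerDeriv f * g + f * eulerDeriv g := eulerDeriv_mul f g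
  have h1 : eulerDeriv (1 : (Polynomial ℝ)⟦X⟧) = 0 := by simp [eulerDeriv]
  rw [hA]
  generalize hf₁ : eulerDeriv f = f₁ at *
  generalize hg₁ : eulerDeriv g = g₁ at *
  have cf₂ := constantCoeff_eulerDeriv f₁
  have cg₂ := constantCoeff_eulerDeriv g₁
  generalize hf₂ : eulerDeriv f₁ = f₂ at *
  generalize hg₂ : eulerDeriv g₁ = g₂ at *
  -- Each equation below differentiates one combination of the products. As `θ f₂ = u t f` and
  -- `θ g₂ = -u t g`, the symmetric combination in `e5` has no `dz / (1 - z)` part, and the others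
  -- change their symmetry under `f ↔ g` at every integration of `dz / (1 - z)`.
  set u := geomTail (Polynomial ℝ) with hu
  set t : (Polynomial ℝ)⟦X⟧ := C Polynomial.X with ht
  have e1 := tCoeff_eq_of_eulerDeriv (f := f * g - 1) (h := f₁ * g + f * g₁) (h' := 0)
    (by simp [cf, cg]) (by rw [eulerDeriv_sub, hA, h1]; ring) k
  have e2 := tCoeff_eq_of_eulerDeriv (f := f₂ * g - f * g₂) (h := f₂ * g₁ - f₁ * g₂)
    (h' := (2 : ℝ) • (t * (f * g))) (by simp [cf₂, cg₂])
    (by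
      rw [eulerDeriv_sub, eulerDeriv_mul, eulerDeriv_mul, hf₃, hg₃, hf₁, hg₁, two_smul]
      ring) k
  have e3 := tCoeff_eq_of_eulerDeriv (f := f₂ * g₁ - f₁ * g₂) (h := 0)
    (h' := t * (f₁ * g + f * g₁)) (by simp [cf₁, cg₁])
    (by rw [eulerDeriv_sub, eulerDeriv_mul, eulerDeriv_mul, hf₃, hg₃, hf₂, hg₂]; ring) k
  have e4 := tCoeff_eq_of_eulerDeriv (f := f₁ * g + f * g₁)
    (h := f₂ * g + f * g₂ + 2 * (f₁ * g₁)) (h' := 0) (by simp [cf₁, cg₁])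
    (by rw [eulerDeriv_add, eulerDeriv_mul, eulerDeriv_mul, hf₁, hg₁, hf₂, hg₂]; ring) k
  have e5 := tCoeff_eq_of_eulerDeriv (f := f₂ * g + f * g₂ + 2 * (f₁ * g₁))
    (h := (3 : ℝ) • (f₂ * g₁ + f₁ * g₂)) (h' := 0) (by simp [cf₁, cg₁, cf₂, cg₂])
    (by
      rw [two_mul, eulerDeriv_add, eulerDeriv_add, eulerDeriv_add, eulerDeriv_mul, eulerDeriv_mul,
        eulerDeriv_mul, hf₃, hg₃, hf₁, hg₁, hf₂, hg₂, ofNat_smul_eq_nsmul, nsmul_eq_mul]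
      push_cast
      ring) k
  have e6 := tCoeff_eq_of_eulerDeriv (f := f₂ * g₁ + f₁ * g₂) (h := (2 : ℝ) • (f₂ * g₂))
    (h' := -(t * (f₁ * g - f * g₁))) (by simp [cf₁, cg₁])
    (by
      rw [eulerDeriv_add, eulerDeriv_mul, eulerDeriv_mul, hf₃, hg₃, hf₂, hg₂, two_smul]
      ring) k
  have e7 := tCoeff_eq_of_eulerDeriv (f := f₂ * g₂) (h := 0)
    (h' := -(t * (f₂ * g - f * g₂))) (by simp [cf₂])
    (by rw [eulerDeriv_mul, hf₃, hg₃]; ring) k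
  simp only [map_zero, add_zero, zero_add, map_smul, map_neg] at e1 e2 e3 e4 e5 e6 e7
  refine ⟨e1, ?_, f₁ * g - f * g₁, ?_, by simp [cf₁, cg₁], ?_⟩
  · rw [e2, e3]
  · rw [eulerDeriv_sub, eulerDeriv_mul, eulerDeriv_mul, hf₁, hg₁, hf₂, hg₂]; ring
  · rw [e4, e5, e6, e7]
    simp only [map_neg, map_add, map_smul, smul_neg, smul_add, neg_smul]

theorem tCoeff_zero_eulerDeriv_shuffle : tCoeff 0 (eulerDeriv shuffleSeries) = 0 := by
  obtain ⟨-, -, d, -, -, h⟩ := tCoeff_shuffle 0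
  simpa [tCoeff_zero_X_mul] using h

theorem tCoeff_zero_shuffle : tCoeff 0 shuffleSeries = mzvCoeff [] := by
  have h := (tCoeff_shuffle 0).1
  rw [tCoeff_zero_eulerDeriv_shuffle, map_zero, map_sub, sub_eq_zero] at h
  rw [h]
  ext N
  by_cases hN : N = 0 <;> simp [tCoeff, mzvCoeff, coeff_one, hN]

theorem tCoeff_shuffle_succ (k : ℕ) :
    tCoeff (k + 1) shuffleSeries = polyX (tCoeff (k + 1) (eulerDeriv shuffleSeries)) := by
  rw [← (tCoeff_shuffle (k + 1)).1, map_sub]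
  ext N
  by_cases hN : N = 0 <;> simp [tCoeff, coeff_one, hN, Polynomial.coeff_one]

/-- The recursion for the shuffle product: the words that survive the cancellation are made of
blocks `xx (xy + yx / 2) (y · + xy · / 2)`. -/
theorem tCoeff_eulerDeriv_shuffle_add_two (k : ℕ) (w : ℕ → ℝ)
    (hw : w = polyY (tCoeff k shuffleSeries) +
      (1 / 2 : ℝ) • polyX (polyY (tCoeff k (eulerDeriv shuffleSeries)))) :
    tCoeff (k + 2) (eulerDeriv shuffleSeries) = (-12 : ℝ) •
      polyX (polyX (polyX (polyY w) + (1 / 2 : ℝ) • polyY (polyX w))) := by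
  -- `d` is the antisymmetric combination `θ f · g - f · θ g`, with `θ d = antiSeries`.
  obtain ⟨-, -, d, hd, cd, h⟩ := tCoeff_shuffle (k + 2)
  have hp := (tCoeff_shuffle (k + 1)).2.1
  simp only [tCoeff_succ_X_mul] at h hp
  have hd' := tCoeff_eq_of_eulerDeriv cd (h := antiSeries) (h' := 0) (by rw [hd]; ring) (k + 1)
  rw [map_zero, map_zero, add_zero] at hd'
  have hw2 : tCoeff (k + 1) antiSeries = (2 : ℝ) • w := by
    rw [hp, hw]; module
  rw [h, hd', hw2]
  simp only [map_smul, map_add, smul_add, smul_smul]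
  norm_num

end Shuffle

/-! ### Coefficients of the Euler products and evaluation at `z = 1` -/

section EulerProduct

open Filter Topology
open Finset.HasAntidiagonal (antidiagonal)

theorem eulerPoly_succ (s : ℕ) (t : Polynomial ℝ) (M : ℕ) :
    eulerPoly s t (M + 1) = eulerPoly s t M +
      Polynomial.C (((M : ℝ) + 1) ^ s)⁻¹ * (t * eulerPoly s t M) := by
  rw [eulerPoly, Finset.prod_range_succ, ← eulerPoly]
  ring

theorem coeff_eulerPoly_nonneg (s M n : ℕ) : 0 ≤ (eulerPoly s Polynomial.X M).coeff n := by
  induction M generalizing n with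
  | zero => simp only [eulerPoly, Finset.prod_range_zero, Polynomial.coeff_one]; split_ifs <;> simp
  | succ M ih =>
    rw [eulerPoly_succ, Polynomial.coeff_add, Polynomial.coeff_C_mul]
    cases n with
    | zero => simpa using ih 0
    | succ n =>
      rw [Polynomial.coeff_X_mul]
      exact add_nonneg (ih _) (mul_nonneg (by positivity) (ih _))

theorem monotone_coeff_eulerPoly (s n : ℕ) :
    Monotone fun M => (eulerPoly s Polynomial.X M).coeff n := by
  refine monotone_nat_of_le_succ fun M => ?_
  rw [eulerPoly_succ, Polynomial.coeff_add, Polynomial.coeff_C_mul]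
  refine le_add_of_nonneg_right (mul_nonneg (by positivity) ?_)
  cases n with
  | zero => simp
  | succ n => rw [Polynomial.coeff_X_mul]; exact coeff_eulerPoly_nonneg _ _ _

/-- A bound for the coefficients of the finite products, uniform in the number of factors. -/
noncomputable def eulerBound (s : ℕ) : ℝ :=
  Real.exp (∑' m : ℕ, (((m : ℝ) + 1) ^ s)⁻¹)

theorem coeff_eulerPoly_le {s : ℕ} (hs : 2 ≤ s) (M n : ℕ) :
    (eulerPoly s Polynomial.X M).coeff n ≤ eulerBound s := by
  have hsum : Summable fun m : ℕ => (((m : ℝ) + 1) ^ s)⁻¹ := by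
    simpa using (summable_nat_add_iff 1).2 (Real.summable_nat_pow_inv.2 (by omega : 1 < s))
  have h1 : (eulerPoly s Polynomial.X M).coeff n ≤ (eulerPoly s Polynomial.X M).eval 1 := by
    rw [Polynomial.eval_eq_sum, Polynomial.sum]
    simp only [one_pow, mul_one]
    by_cases hn : n ∈ (eulerPoly s Polynomial.X M).support
    · exact Finset.single_le_sum (f := fun i => (eulerPoly s Polynomial.X M).coeff i)
        (fun i _ => coeff_eulerPoly_nonneg s M i) hn
    · rw [Polynomial.notMem_support_iff.1 hn]
      exact Finset.sum_nonneg fun i _ => coeff_eulerPoly_nonneg s M i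
  refine h1.trans ?_
  rw [eulerPoly, Polynomial.eval_prod]
  simp only [Polynomial.eval_add, Polynomial.eval_one, Polynomial.eval_mul, Polynomial.eval_C,
    Polynomial.eval_X, mul_one]
  refine (Real.prod_one_add_le_exp_sum _ fun m => by positivity).trans (Real.exp_le_exp.2 ?_)
  exact hsum.sum_le_tsum _ fun m _ => by positivity

/-- The `n`-th elementary symmetric function of the numbers `1 / m ^ s`, `m ≥ 1`; it is
`ζ({s}^n)`. -/
noncomputable def eulerCoeff (s n : ℕ) : ℝ :=
  ⨆ M, (eulerPoly s Polynomial.X M).coeff n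

theorem tendsto_coeff_eulerPoly {s : ℕ} (hs : 2 ≤ s) (n : ℕ) :
    Tendsto (fun M => (eulerPoly s Polynomial.X M).coeff n) atTop (𝓝 (eulerCoeff s n)) :=
  tendsto_atTop_ciSup (monotone_coeff_eulerPoly s n)
    ⟨eulerBound s, by rintro _ ⟨M, rfl⟩; exact coeff_eulerPoly_le hs M n⟩

theorem coeff_eulerPoly_neg (s M n : ℕ) :
    (eulerPoly s (-Polynomial.X) M).coeff n = (-1) ^ n * (eulerPoly s Polynomial.X M).coeff n := by
  have h : eulerPoly s (-Polynomial.X) M =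
      (eulerPoly s Polynomial.X M).comp (Polynomial.C (-1) * Polynomial.X) := by
    simp [eulerPoly, Polynomial.prod_comp]
  rw [h, Polynomial.comp_C_mul_X_coeff, mul_comm]

theorem coeff_eulerPoly_mul_neg (s M n : ℕ) :
    (eulerPoly s Polynomial.X M * eulerPoly s (-Polynomial.X) M).coeff (2 * n) =
      (-1) ^ n * (eulerPoly (2 * s) Polynomial.X M).coeff n := by
  have h : eulerPoly s Polynomial.X M * eulerPoly s (-Polynomial.X) M =
      Polynomial.expand ℝ 2 (eulerPoly (2 * s) (-Polynomial.X) M) := by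
    simp only [eulerPoly, map_prod, ← Finset.prod_mul_distrib]
    refine Finset.prod_congr rfl fun m _ => ?_
    simp only [map_add, map_mul, map_neg, map_one, Polynomial.expand_C, Polynomial.expand_X]
    rw [show (((m : ℝ) + 1) ^ (2 * s))⁻¹ = (((m : ℝ) + 1) ^ s)⁻¹ * (((m : ℝ) + 1) ^ s)⁻¹ by
      rw [← mul_inv, ← pow_add, two_mul], Polynomial.C_mul]
    ring
  rw [h, mul_comm 2 n, Polynomial.coeff_expand_mul two_pos, coeff_eulerPoly_neg]

theorem coeff_threeSeries_neg (N n : ℕ) :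
    (PowerSeries.coeff N (threeSeries (-Polynomial.X))).coeff n =
      (-1) ^ n * (PowerSeries.coeff N (threeSeries Polynomial.X)).coeff n := by
  simp only [threeSeries, PowerSeries.coeff_mk]
  split_ifs
  · rcases eq_or_ne n 0 with rfl | hn <;> simp [Polynomial.coeff_one, *]
  · rw [Polynomial.coeff_sub, coeff_eulerPoly_neg, coeff_eulerPoly_neg, Polynomial.coeff_sub,
      mul_sub]

theorem summable_coeff_threeSeries (n : ℕ) :
    Summable fun N => (PowerSeries.coeff N (threeSeries Polynomial.X)).coeff n := by
  refine summable_of_sum_range_le (c := eulerBound 3) (fun N => ?_) fun N => ?_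
  · simp only [threeSeries, PowerSeries.coeff_mk]
    split_ifs
    · rw [Polynomial.coeff_one]; split_ifs <;> simp
    · rw [Polynomial.coeff_sub, sub_nonneg]
      exact monotone_coeff_eulerPoly 3 n (Nat.sub_le _ _)
  · cases N with
    | zero => simpa [eulerBound] using (Real.exp_pos _).le
    | succ M =>
      rw [← Polynomial.finsetSum_coeff, sum_coeff_threeSeries]
      exact coeff_eulerPoly_le (by norm_num) M n

/-- Evaluation of the shuffle product at `z = 1`, by Cauchy multiplication of convergent series. -/
theorem hasSum_tCoeff_shuffle (n : ℕ) :
    HasSum (tCoeff (2 * n) shuffleSeries) ((-1) ^ n * eulerCoeff 6 n) := by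
  set f : ℕ → ℕ → ℝ := fun a N => (PowerSeries.coeff N (threeSeries Polynomial.X)).coeff a with hf
  set g : ℕ → ℕ → ℝ := fun a N => (PowerSeries.coeff N (threeSeries (-Polynomial.X))).coeff a
    with hg
  have hsf : ∀ a, Summable fun N => ‖f a N‖ := fun a => (summable_coeff_threeSeries a).norm
  have hsg : ∀ a, Summable fun N => ‖g a N‖ := fun a => by
    have : g a = fun N => (-1) ^ a * f a N := funext fun N => coeff_threeSeries_neg N a
    rw [this]
    exact ((summable_coeff_threeSeries a).mul_left _).norm
  have hsum : HasSum (tCoeff (2 * n) shuffleSeries)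
      (∑ p ∈ antidiagonal (2 * n), (∑' N, f p.1 N) * ∑' N, g p.2 N) := by
    have h : tCoeff (2 * n) shuffleSeries = fun N => ∑ p ∈ antidiagonal (2 * n),
        ∑ q ∈ antidiagonal N, f p.1 q.1 * g p.2 q.2 := by
      ext N
      change (PowerSeries.coeff N (threeSeries Polynomial.X *
        threeSeries (-Polynomial.X))).coeff _ = _
      rw [PowerSeries.coeff_mul, Polynomial.finsetSum_coeff, Finset.sum_comm]
      simp only [Polynomial.coeff_mul, hf, hg]
    rw [h]
    refine hasSum_sum fun p _ => ?_
    rw [tsum_mul_tsum_eq_tsum_sum_antidiagonal_of_summable_norm (hsf _) (hsg _)]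
    exact (summable_norm_sum_mul_antidiagonal_of_summable_norm (hsf _) (hsg _)).of_norm.hasSum
  have hlim : Tendsto (fun M => ∑ p ∈ antidiagonal (2 * n),
      (∑ N ∈ Finset.range (M + 1), f p.1 N) * ∑ N ∈ Finset.range (M + 1), g p.2 N) atTop
      (𝓝 (∑ p ∈ antidiagonal (2 * n), (∑' N, f p.1 N) * ∑' N, g p.2 N)) :=
    tendsto_finsetSum _ fun p _ =>
      ((tendsto_add_atTop_iff_nat 1).2 (hsf p.1).of_norm.hasSum.tendsto_sum_nat).mul
        ((tendsto_add_atTop_iff_nat 1).2 (hsg p.2).of_norm.hasSum.tendsto_sum_nat)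
  have heq : ∀ M, ∑ p ∈ antidiagonal (2 * n),
      (∑ N ∈ Finset.range (M + 1), f p.1 N) * ∑ N ∈ Finset.range (M + 1), g p.2 N =
      (-1) ^ n * (eulerPoly 6 Polynomial.X M).coeff n := fun M => by
    rw [← coeff_eulerPoly_mul_neg 3, Polynomial.coeff_mul]
    refine Finset.sum_congr rfl fun p _ => ?_
    simp only [hf, hg, ← Polynomial.finsetSum_coeff, sum_coeff_threeSeries]
  simp only [heq] at hlim
  rwa [tendsto_nhds_unique hlim
    ((tendsto_coeff_eulerPoly (by norm_num) n).const_mul _)] at hsum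

/-! ### The value of `ζ({6}^n)` -/

theorem sin_mul_sin_mul_sin_of_add_eq_zero {a b c : ℂ} (h : a + b + c = 0) :
    4 * (Complex.sin a * Complex.sin b * Complex.sin c) =
      -(Complex.sin (2 * a) + Complex.sin (2 * b) + Complex.sin (2 * c)) := by
  obtain rfl : c = -(a + b) := by linear_combination h
  have ha := Complex.sin_sq_add_cos_sq a
  have hb := Complex.sin_sq_add_cos_sq b
  rw [mul_neg, Complex.sin_neg, Complex.sin_neg, Complex.sin_two_mul, Complex.sin_two_mul,
    Complex.sin_two_mul, Complex.sin_add, Complex.cos_add]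
  linear_combination (-2 * Complex.sin b * Complex.cos b) * ha +
    (-2 * Complex.sin a * Complex.cos a) * hb

/-- Averaging the sine series over the cube roots of unity keeps the exponents divisible by `3`. -/
theorem hasSum_sin_rotations {ω : ℂ} (hω : IsPrimitiveRoot ω 3) (y : ℂ) :
    HasSum (fun n : ℕ => -3 * (-1) ^ n * y ^ (6 * n + 3) / ((6 * n + 3)! : ℂ))
      (Complex.sin y + Complex.sin (ω * y) + Complex.sin (ω ^ 2 * y)) := by
  have h := ((Complex.hasSum_sin y).add (Complex.hasSum_sin (ω * y))).add
    (Complex.hasSum_sin (ω ^ 2 * y))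
  have h3 : ω ^ 3 = 1 := hω.pow_eq_one
  have h0 : 1 + ω + ω ^ 2 = 0 := by
    simpa [Finset.sum_range_succ] using hω.geom_sum_eq_zero (by norm_num)
  have hinj : Function.Injective fun n : ℕ => 3 * n + 1 := fun a b hab => by
    simpa using hab
  rw [← hinj.hasSum_iff] at h
  · refine (congrArg (HasSum · _) (funext fun n => ?_)).mpr h
    have e : 2 * (3 * n + 1) + 1 = 6 * n + 3 := by ring
    have e1 : ω ^ (6 * n + 3) = 1 := by
      rw [show 6 * n + 3 = 3 * (2 * n + 1) by ring, pow_mul, h3, one_pow]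
    have e2 : (-1 : ℂ) ^ (3 * n + 1) = -(-1) ^ n := by
      rw [pow_succ, pow_mul]; norm_num
    simp only [Function.comp_apply, e, mul_pow, ← pow_mul ω 2, mul_comm 2 (6 * n + 3)]
    rw [pow_mul ω, e1, e2]
    ring
  · intro k hk
    have hmod : ω ^ (2 * k + 1) = ω ∨ ω ^ (2 * k + 1) = ω ^ 2 := by
      have hk' : k % 3 = 0 ∨ k % 3 = 2 := by
        by_contra hc
        exact hk ⟨k / 3, by change 3 * (k / 3) + 1 = k; omega⟩
      rw [← pow_mod_orderOf, ← hω.eq_orderOf]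
      rcases hk' with hk' | hk'
      · left; rw [show (2 * k + 1) % 3 = 1 by omega, pow_one]
      · right; rw [show (2 * k + 1) % 3 = 2 by omega]
    simp only [mul_pow, ← pow_mul ω 2, mul_comm 2 (2 * k + 1)]
    rw [pow_mul ω]
    rcases hmod with e | e <;> rw [e]
    · linear_combination ((-1) ^ k * y ^ (2 * k + 1) / ((2 * k + 1)! : ℂ)) * h0
    · have e4 : (ω ^ 2) ^ 2 = ω := by linear_combination ω * h3
      rw [e4]
      linear_combination ((-1) ^ k * y ^ (2 * k + 1) / ((2 * k + 1)! : ℂ)) * h0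

/-- Over the complex numbers `1 - z ^ 6 / m ^ 6` splits into the factors `1 - (ωʲ z) ^ 2 / m ^ 2`,
so that the product over `m` is a product of three sines. -/
theorem tendsto_aeval_eulerPoly_sin {ω z : ℂ} (hω : IsPrimitiveRoot ω 3) (hz : z ≠ 0) :
    Tendsto (fun M => Polynomial.aeval (-z ^ 6) (eulerPoly 6 Polynomial.X M)) atTop
      (𝓝 (-(Complex.sin (2 * Real.pi * z) + Complex.sin (ω * (2 * Real.pi * z)) +
        Complex.sin (ω ^ 2 * (2 * Real.pi * z))) / (4 * (Real.pi * z) ^ 3))) := by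
  have h3 : ω ^ 3 = 1 := hω.pow_eq_one
  have h0 : 1 + ω + ω ^ 2 = 0 := by
    simpa [Finset.sum_range_succ] using hω.geom_sum_eq_zero (by norm_num)
  have hpi : (Real.pi : ℂ) ≠ 0 := Complex.ofReal_ne_zero.2 Real.pi_ne_zero
  have h := ((Complex.tendsto_euler_sin_prod z).mul (Complex.tendsto_euler_sin_prod (ω * z))).mul
    (Complex.tendsto_euler_sin_prod (ω ^ 2 * z))
  have h' := h.div_const ((Real.pi * z) ^ 3)
  have hs := sin_mul_sin_mul_sin_of_add_eq_zero
    (a := Real.pi * z) (b := Real.pi * (ω * z)) (c := Real.pi * (ω ^ 2 * z))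
    (by linear_combination (Real.pi * z) * h0)
  have hlim : Complex.sin (Real.pi * z) * Complex.sin (Real.pi * (ω * z)) *
      Complex.sin (Real.pi * (ω ^ 2 * z)) / (Real.pi * z) ^ 3 =
      -(Complex.sin (2 * Real.pi * z) + Complex.sin (ω * (2 * Real.pi * z)) +
        Complex.sin (ω ^ 2 * (2 * Real.pi * z))) / (4 * (Real.pi * z) ^ 3) := by
    rw [show 2 * (Real.pi : ℂ) * z = 2 * (Real.pi * z) by ring,
      show ω * (2 * (Real.pi * z)) = 2 * (Real.pi * (ω * z)) by ring,
      show ω ^ 2 * (2 * (Real.pi * z)) = 2 * (Real.pi * (ω ^ 2 * z)) by ring, ← hs,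
      mul_div_mul_left _ _ (by norm_num : (4 : ℂ) ≠ 0)]
  rw [hlim] at h'
  refine h'.congr fun M => ?_
  rw [div_eq_iff (pow_ne_zero 3 (mul_ne_zero hpi hz))]
  have hprod : Polynomial.aeval (-z ^ 6) (eulerPoly 6 Polynomial.X M) =
      (∏ j ∈ Finset.range M, (1 - z ^ 2 / ((j : ℂ) + 1) ^ 2)) *
      (∏ j ∈ Finset.range M, (1 - (ω * z) ^ 2 / ((j : ℂ) + 1) ^ 2)) *
      ∏ j ∈ Finset.range M, (1 - (ω ^ 2 * z) ^ 2 / ((j : ℂ) + 1) ^ 2) := by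
    rw [← Finset.prod_mul_distrib, ← Finset.prod_mul_distrib, eulerPoly, map_prod]
    refine Finset.prod_congr rfl fun j _ => ?_
    simp only [map_add, map_one, map_mul, Polynomial.aeval_C, Polynomial.aeval_X]
    have hj : ((algebraMap ℝ ℂ) (((j : ℝ) + 1) ^ 6)⁻¹) = ((((j : ℂ) + 1) ^ 2)⁻¹) ^ 3 := by
      simp [← pow_mul]
    rw [hj]
    simp only [div_eq_mul_inv]
    generalize (((j : ℂ) + 1) ^ 2)⁻¹ = u
    have h1 : ω ^ 4 = ω := by linear_combination ω * h3
    have h6 : ω ^ 6 = 1 := by linear_combination (ω ^ 3 + 1) * h3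
    linear_combination (u * z ^ 2 - u ^ 2 * z ^ 4 * ω ^ 2) * (h0 + h1) + u ^ 3 * z ^ 6 * h6
  rw [hprod]
  linear_combination (-(Real.pi * z) ^ 3 * (∏ j ∈ Finset.range M, (1 - z ^ 2 / ((j : ℂ) + 1) ^ 2)) *
      (∏ j ∈ Finset.range M, (1 - (ω * z) ^ 2 / ((j : ℂ) + 1) ^ 2)) *
      ∏ j ∈ Finset.range M, (1 - (ω ^ 2 * z) ^ 2 / ((j : ℂ) + 1) ^ 2)) * (-h3)

theorem eulerCoeff_nonneg {s : ℕ} (hs : 2 ≤ s) (n : ℕ) : 0 ≤ eulerCoeff s n :=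
  ge_of_tendsto' (tendsto_coeff_eulerPoly hs n) fun M => coeff_eulerPoly_nonneg s M n

theorem summable_eulerBound_mul_pow (s : ℕ) {v : ℂ} (hv : ‖v‖ < 1) :
    Summable fun n : ℕ => eulerBound s * ‖v‖ ^ n :=
  (summable_geometric_of_lt_one (norm_nonneg v) hv).mul_left _

theorem tendsto_aeval_eulerPoly {s : ℕ} (hs : 2 ≤ s) {v : ℂ} (hv : ‖v‖ < 1) :
    Tendsto (fun M => Polynomial.aeval v (eulerPoly s Polynomial.X M)) atTop
      (𝓝 (∑' n : ℕ, v ^ n * (eulerCoeff s n : ℂ))) := by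
  have key := tendsto_tsum_of_dominated_convergence (summable_eulerBound_mul_pow s hv)
    (𝓕 := atTop)
    (f := fun M n => v ^ n * (((eulerPoly s Polynomial.X M).coeff n : ℝ) : ℂ))
    (g := fun n => v ^ n * (eulerCoeff s n : ℂ))
    (fun n => ((Complex.continuous_ofReal.tendsto _).comp
      (tendsto_coeff_eulerPoly hs n)).const_mul _)
    (Eventually.of_forall fun M n => by
      rw [norm_mul, norm_pow, Complex.norm_real, Real.norm_of_nonneg
        (coeff_eulerPoly_nonneg _ _ _), mul_comm]
      exact mul_le_mul_of_nonneg_right (coeff_eulerPoly_le hs M n) (by positivity))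
  refine key.congr fun M => ?_
  rw [Polynomial.aeval_def, Polynomial.eval₂_eq_sum, Polynomial.sum]
  rw [tsum_eq_sum (s := (eulerPoly s Polynomial.X M).support) fun n hn => by
    rw [Polynomial.notMem_support_iff.1 hn]; simp]
  exact Finset.sum_congr rfl fun n _ => mul_comm _ _

/-- The value `ζ({6}^n) = 6 (2 π) ^ (6 n) / (6 n + 3)!`. -/
theorem eulerCoeff_six (n : ℕ) :
    eulerCoeff 6 n = 6 * (2 * Real.pi) ^ (6 * n) / ((6 * n + 3)! : ℝ) := by
  let b : ℕ → ℂ := fun n => 6 * (2 * Real.pi) ^ (6 * n) / ((6 * n + 3)! : ℂ)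
  let F : ℂ → ℂ := fun v => ∑' n : ℕ, v ^ n * (eulerCoeff 6 n : ℂ)
  have hball : ∀ᶠ v : ℂ in 𝓝 0, ‖v‖ < 1 :=
    (continuous_norm.tendsto (0 : ℂ)).eventually_lt_const (by simp)
  have h1 : HasFPowerSeriesAt F
      (FormalMultilinearSeries.ofScalars ℂ fun n => (eulerCoeff 6 n : ℂ)) 0 := by
    rw [hasFPowerSeriesAt_iff]
    filter_upwards [hball] with v hv
    simp only [FormalMultilinearSeries.coeff_ofScalars, smul_eq_mul, zero_add]
    refine Summable.hasSum (Summable.of_norm_bounded (summable_eulerBound_mul_pow 6 hv) fun n => ?_)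
    rw [norm_mul, norm_pow, Complex.norm_real, Real.norm_of_nonneg
      (eulerCoeff_nonneg (by norm_num) n), mul_comm]
    exact mul_le_mul_of_nonneg_right (le_of_tendsto' (tendsto_coeff_eulerPoly (by norm_num) n)
      fun M => coeff_eulerPoly_le (by norm_num) M n) (by positivity)
  have h2 : HasFPowerSeriesAt F (FormalMultilinearSeries.ofScalars ℂ b) 0 := by
    rw [hasFPowerSeriesAt_iff]
    filter_upwards [hball] with v hv
    simp only [FormalMultilinearSeries.coeff_ofScalars, smul_eq_mul, zero_add]
    have hlim := tendsto_aeval_eulerPoly (s := 6) (by norm_num) hv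
    rcases eq_or_ne v 0 with rfl | hv0
    · have hF : F 0 = 1 := tendsto_nhds_unique hlim (by simp [eulerPoly, map_prod])
      have hb : (0 : ℂ) ^ 0 * b 0 = 1 := by norm_num [b, Nat.factorial]
      have h : HasSum (fun n => (0 : ℂ) ^ n * b n) ((0 : ℂ) ^ 0 * b 0) :=
        hasSum_single 0 fun n hn => by simp [hn]
      rwa [hb, ← hF] at h
    · obtain ⟨z, hz⟩ := IsAlgClosed.exists_pow_nat_eq (-v) (n := 6) (by norm_num)
      have hz0 : z ≠ 0 := by
        rintro rfl
        exact hv0 (by simpa using hz.symm)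
      obtain rfl : v = -z ^ 6 := by rw [hz, neg_neg]
      have hω := Complex.isPrimitiveRoot_exp 3 (by norm_num)
      change HasSum _ (∑' n : ℕ, _)
      rw [tendsto_nhds_unique hlim (tendsto_aeval_eulerPoly_sin hω hz0)]
      have hpi : (Real.pi : ℂ) ≠ 0 := Complex.ofReal_ne_zero.2 Real.pi_ne_zero
      have hsum := ((hasSum_sin_rotations hω (2 * Real.pi * z)).neg).div_const
        (4 * (Real.pi * z) ^ 3)
      refine (congrArg (HasSum · _) (funext fun n => ?_)).mpr hsum
      have hfac : ((6 * n + 3)! : ℂ) ≠ 0 := Nat.cast_ne_zero.2 (Nat.factorial_ne_zero _)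
      have e : (-z ^ 6) ^ n = (-1) ^ n * z ^ (6 * n) := by rw [neg_pow, ← pow_mul]
      rw [e]
      simp only [b]
      field_simp
      ring
  have h3 := congrArg (fun p => FormalMultilinearSeries.coeff p n)
    (h1.eq_formalMultilinearSeries h2)
  simp only [FormalMultilinearSeries.coeff_ofScalars, b] at h3
  exact_mod_cast h3

end EulerProduct

/-! ### The sum over the blocks -/

/-- The concatenation of the pairs `[5 - δ i - ε i, 1 + ε i + δ (i + 1)]`. -/
def pairIndex {n : ℕ} (ε : Fin n → Fin 2) (δ : ℕ → ℕ) : List ℕ :=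
  (List.ofFn fun i : Fin n =>
    [5 - δ (i : ℕ) - (ε i : ℕ), 1 + (ε i : ℕ) + δ ((i : ℕ) + 1)]).flatten

theorem pairIndex_cons {n : ℕ} (a : Fin 2) (ε : Fin n → Fin 2) (δ : ℕ → ℕ) :
    pairIndex (Fin.cons a ε : Fin (n + 1) → Fin 2) δ =
      (5 - δ 0 - (a : ℕ)) :: (1 + (a : ℕ) + δ 1) :: pairIndex ε fun j => δ (j + 1) := by
  simp [pairIndex, List.ofFn_succ]

/-- The sequence `ε'₀, ε'₁, …, ε'ₙ` with `ε'₀ = e` and `ε'ₙ = 0`, for `n ≥ 1`. -/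
def extendStart {n : ℕ} (e : ℕ) (ε' : Fin (n - 1) → Fin 2) (j : ℕ) : ℕ :=
  if j = 0 then e else extendZero ε' j

theorem extendStart_zero {n : ℕ} (ε' : Fin (n - 1) → Fin 2) :
    extendStart 0 ε' = extendZero ε' := by
  ext j
  by_cases h : j = 0 <;> simp [extendStart, extendZero, h]

theorem extendStart_cons {m : ℕ} (e : ℕ) (b : Fin 2) (ε' : Fin m → Fin 2) :
    (fun j => extendStart (n := m + 2) e (Fin.cons b ε' : Fin (m + 1) → Fin 2) (j + 1)) =
      extendStart (n := m + 1) (b : ℕ) ε' := by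
  ext j
  cases j with
  | zero => simp [extendStart, extendZero, Fin.cons]
  | succ j =>
    simp only [extendStart, extendZero]
    by_cases h : j < m
    · simp only [Nat.add_eq_zero_iff, one_ne_zero, and_false, if_false]
      rw [dif_pos (by omega), dif_pos (by omega)]
      exact congrArg Fin.val (Fin.cons_succ (α := fun _ => Fin 2) b ε' ⟨j, h⟩)
    · simp only [Nat.add_eq_zero_iff, one_ne_zero, and_false, if_false]
      rw [dif_neg (by omega), dif_neg (by omega)]

/-- The coefficients of the sum over all `ε`, `ε'` of `12 ^ n / 2 ^ (∑ ε + ∑ ε')` times the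
polylogarithm of index `{5 - ε'_{i-1} - ε_i, 1 + ε_i + ε'_i}`, with `ε'₀ = e` and `ε'ₙ = 0`. -/
noncomputable def blockSum (n e : ℕ) : ℕ → ℝ :=
  ∑ ε : Fin n → Fin 2, ∑ ε' : Fin (n - 1) → Fin 2,
    ((12 : ℝ) ^ n / 2 ^ ((∑ i, (ε i : ℕ)) + (∑ j, (ε' j : ℕ)))) •
      mzvCoeff (pairIndex ε (extendStart e ε'))

theorem sum_pi_fin_succ {V : Type*} [AddCommMonoid V] {n : ℕ} (F : (Fin (n + 1) → Fin 2) → V) :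
    ∑ ε, F ε = ∑ a : Fin 2, ∑ ε : Fin n → Fin 2, F (Fin.cons a ε) := by
  rw [← (Fin.consEquiv fun _ : Fin (n + 1) => Fin 2).sum_comp, Fintype.sum_prod_type]
  rfl

/-- The operator that puts the pair `(5 - e - a, 1 + a + b)` in front of an index. -/
noncomputable def pairOp (e a b : ℕ) : (ℕ → ℝ) →ₗ[ℝ] (ℕ → ℝ) :=
  (polyX ^ (4 - e - a)) ∘ₗ polyY ∘ₗ (polyX ^ (a + b)) ∘ₗ polyY

theorem mzvCoeff_pair {e a b : ℕ} (he : e ≤ 1) (ha : a ≤ 1) (ks : List ℕ) :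
    mzvCoeff ((5 - e - a) :: (1 + a + b) :: ks) = pairOp e a b (mzvCoeff ks) := by
  rw [show 5 - e - a = (4 - e - a) + 1 by omega, show 1 + a + b = (a + b) + 1 by omega,
    mzvCoeff_cons, mzvCoeff_cons]
  simp only [pairOp, LinearMap.comp_apply, Module.End.pow_apply]

theorem blockSum_one {e : ℕ} (he : e ≤ 1) :
    blockSum 1 e = (12 : ℝ) • ∑ a : Fin 2, ((1 : ℝ) / 2 ^ (a : ℕ)) •
      pairOp e a 0 (mzvCoeff []) := by
  have hu : ∀ G : (Fin (1 - 1) → Fin 2) → ℕ → ℝ, ∑ ε', G ε' = G Fin.elim0 := fun G =>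
    (Fintype.sum_unique (ι := Fin 0 → Fin 2) G).trans (congrArg G (funext fun i => i.elim0))
  rw [blockSum, sum_pi_fin_succ, Finset.smul_sum]
  refine Finset.sum_congr rfl fun a _ => ?_
  rw [Fintype.sum_unique, hu, pairIndex_cons, smul_smul]
  have h0 : extendStart (n := 1) e Fin.elim0 0 = e := rfl
  have h1 : extendStart (n := 1) e Fin.elim0 1 = 0 := rfl
  rw [h0, h1, mzvCoeff_pair he (by omega)]
  congr 1
  simp [div_eq_mul_inv]

theorem blockSum_add_two {m e : ℕ} (he : e ≤ 1) :
    blockSum (m + 2) e = (12 : ℝ) • ∑ a : Fin 2, ∑ b : Fin 2,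
      ((1 : ℝ) / 2 ^ ((a : ℕ) + (b : ℕ))) • pairOp e a b (blockSum (m + 1) b) := by
  rw [blockSum, sum_pi_fin_succ, Finset.smul_sum]
  refine Finset.sum_congr rfl fun a _ => ?_
  trans ∑ ε : Fin (m + 1) → Fin 2, ∑ b : Fin 2, ∑ ε' : Fin m → Fin 2,
    ((12 : ℝ) ^ (m + 2) / 2 ^ ((∑ i, ((Fin.cons a ε : Fin (m + 2) → Fin 2) i : ℕ)) +
      ∑ j, ((Fin.cons b ε' : Fin (m + 1) → Fin 2) j : ℕ))) •
      mzvCoeff (pairIndex (Fin.cons a ε : Fin (m + 2) → Fin 2)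
        (extendStart (n := m + 2) e (Fin.cons b ε' : Fin (m + 1) → Fin 2)))
  · exact Finset.sum_congr rfl fun ε _ => sum_pi_fin_succ (n := m) _
  rw [Finset.sum_comm, Finset.smul_sum]
  refine Finset.sum_congr rfl fun b _ => ?_
  rw [blockSum, map_sum, Finset.smul_sum, Finset.smul_sum]
  refine Finset.sum_congr rfl fun ε _ => ?_
  rw [map_sum, Finset.smul_sum, Finset.smul_sum]
  refine Finset.sum_congr rfl fun ε' _ => ?_
  have h0 : extendStart (n := m + 2) e (Fin.cons b ε' : Fin (m + 1) → Fin 2) 0 = e := rfl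
  have h1 : extendStart (n := m + 2) e (Fin.cons b ε' : Fin (m + 1) → Fin 2) 1 = b := rfl
  rw [pairIndex_cons, h0, h1, extendStart_cons, mzvCoeff_pair he (by omega), map_smul, smul_smul,
    smul_smul]
  congr 1
  have s1 : ∑ i, ((Fin.cons a ε : Fin (m + 2) → Fin 2) i : ℕ) = a + ∑ i, (ε i : ℕ) := by
    rw [Fin.sum_univ_succ]; simp only [Fin.cons_zero, Fin.cons_succ]
  have s2 : ∑ j, ((Fin.cons b ε' : Fin (m + 1) → Fin 2) j : ℕ) = b + ∑ j, (ε' j : ℕ) := by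
    rw [Fin.sum_univ_succ]; simp only [Fin.cons_zero, Fin.cons_succ]
  change (12 : ℝ) ^ (m + 2) / 2 ^ (_ + _) =
    12 * (1 / 2 ^ ((a : ℕ) + b)) * (12 ^ (m + 1) / 2 ^ (_ + ∑ j : Fin m, (ε' j : ℕ)))
  rw [s1, s2]
  field_simp
  ring

/-- The recursion step in terms of the values `w₀`, `w₁` of the remaining sum for `ε' = 0, 1`. -/
theorem sum_pairOp (w : ℕ → ℕ → ℝ) :
    ∑ a : Fin 2, ∑ b : Fin 2, ((1 : ℝ) / 2 ^ ((a : ℕ) + (b : ℕ))) • pairOp 1 a b (w b) =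
      polyX (polyX (polyX (polyY (polyY (w 0) + (1 / 2 : ℝ) • polyX (polyY (w 1)))) +
        (1 / 2 : ℝ) • polyY (polyX (polyY (w 0) + (1 / 2 : ℝ) • polyX (polyY (w 1)))))) := by
  simp only [Fin.sum_univ_two, pairOp, LinearMap.comp_apply, Module.End.pow_apply]
  simp [Function.iterate_succ_apply']
  module

theorem pairOp_zero {a : ℕ} (ha : a ≤ 1) (b : ℕ) (w : ℕ → ℝ) :
    pairOp 0 a b w = polyX (pairOp 1 a b w) := by
  simp only [pairOp, LinearMap.comp_apply, Module.End.pow_apply]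
  rw [show 4 - 0 - a = (4 - 1 - a) + 1 by omega, Function.iterate_succ_apply']

theorem blockSum_zero_eq_polyX (n : ℕ) : blockSum (n + 1) 0 = polyX (blockSum (n + 1) 1) := by
  cases n with
  | zero =>
    rw [blockSum_one zero_le_one, blockSum_one le_rfl]
    simp only [map_smul, map_sum]
    refine congrArg _ (Finset.sum_congr rfl fun a _ => ?_)
    rw [pairOp_zero (by omega)]
  | succ n =>
    rw [blockSum_add_two zero_le_one, blockSum_add_two le_rfl]
    simp only [map_smul, map_sum]
    refine congrArg _ (Finset.sum_congr rfl fun a _ => Finset.sum_congr rfl fun b _ => ?_)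
    rw [pairOp_zero (by omega)]

/-- The shuffle recursion and the block recursion agree. -/
theorem blockSum_one_eq (n : ℕ) :
    blockSum (n + 1) 1 = (-1 : ℝ) ^ (n + 1) • tCoeff (2 * (n + 1)) (eulerDeriv shuffleSeries) := by
  induction n with
  | zero =>
    have h := sum_pairOp fun b => if b = 0 then mzvCoeff [] else 0
    rw [tCoeff_eulerDeriv_shuffle_add_two 0 _ rfl, tCoeff_zero_eulerDeriv_shuffle,
      tCoeff_zero_shuffle, blockSum_one le_rfl]
    simp [Fin.sum_univ_two] at h ⊢
    rw [← smul_add, ← smul_add, h]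
  | succ n ih =>
    have h := sum_pairOp fun b => blockSum (n + 1) b
    rw [blockSum_add_two le_rfl, h, blockSum_zero_eq_polyX, ih,
      show 2 * (n + 1 + 1) = 2 * (n + 1) + 2 by ring,
      tCoeff_eulerDeriv_shuffle_add_two (2 * (n + 1)) _ rfl,
      show 2 * (n + 1) = 2 * n + 1 + 1 by ring, tCoeff_shuffle_succ]
    simp only [map_smul, map_add, smul_add, smul_smul]
    module

theorem blockSum_zero_eq (n : ℕ) :
    blockSum n 0 = (-1 : ℝ) ^ n • tCoeff (2 * n) shuffleSeries := by
  cases n with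
  | zero =>
    rw [tCoeff_zero_shuffle]
    simp [blockSum, pairIndex]
  | succ n =>
    rw [blockSum_zero_eq_polyX, blockSum_one_eq, map_smul,
      show 2 * (n + 1) = 2 * n + 1 + 1 by ring, tCoeff_shuffle_succ]

theorem hasSum_blockSum (n : ℕ) : HasSum (blockSum n 0) (eulerCoeff 6 n) := by
  have h := (hasSum_tCoeff_shuffle n).mul_left ((-1 : ℝ) ^ n)
  rw [← mul_assoc, ← mul_pow, neg_one_mul, neg_neg, one_pow, one_mul] at h
  rw [blockSum_zero_eq]
  exact h

theorem mainTheorem2 (n : ℕ) :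
    (∀ (ε : Fin n → Fin 2) (ε' : Fin (n - 1) → Fin 2), MZVConverges (kIndex ε ε')) ∧
    (∑ ε : Fin n → Fin 2, ∑ ε' : Fin (n - 1) → Fin 2,
        (12 : ℝ) ^ n / 2 ^ ((∑ i, (ε i : ℕ)) + (∑ j, (ε' j : ℕ))) * mzv (kIndex ε ε'))
      = 6 * (2 * Real.pi) ^ (6 * n) / ((6 * n + 3)! : ℝ) := by
  have hblock : ∀ N, blockSum n 0 N = ∑ ε : Fin n → Fin 2, ∑ ε' : Fin (n - 1) → Fin 2,
      (12 : ℝ) ^ n / 2 ^ ((∑ i, (ε i : ℕ)) + (∑ j, (ε' j : ℕ))) * mzvCoeff (kIndex ε ε') N := by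
    intro N
    simp only [blockSum, Finset.sum_apply, Pi.smul_apply, smul_eq_mul, extendStart_zero]
    rfl
  have hs : ∀ (ε : Fin n → Fin 2) (ε' : Fin (n - 1) → Fin 2),
      Summable (mzvCoeff (kIndex ε ε')) := by
    intro ε ε'
    -- All terms are nonnegative, so each series is dominated by the convergent weighted sum.
    have hc : (0 : ℝ) < 12 ^ n / 2 ^ ((∑ i, (ε i : ℕ)) + (∑ j, (ε' j : ℕ))) := by positivity
    refine (summable_mul_left_iff hc.ne').1 ((hasSum_blockSum n).summable.of_nonneg_of_le
      (fun N => mul_nonneg hc.le (mzvCoeff_nonneg _ N)) fun N => ?_)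
    rw [hblock]
    refine (Finset.single_le_sum (f := fun ε' : Fin (n - 1) → Fin 2 =>
      (12 : ℝ) ^ n / 2 ^ ((∑ i, (ε i : ℕ)) + (∑ j, (ε' j : ℕ))) * mzvCoeff (kIndex ε ε') N)
      (fun ε' _ => mul_nonneg (by positivity) (mzvCoeff_nonneg _ N))
      (Finset.mem_univ ε')).trans ?_
    exact Finset.single_le_sum (f := fun ε : Fin n → Fin 2 => ∑ ε' : Fin (n - 1) → Fin 2,
      (12 : ℝ) ^ n / 2 ^ ((∑ i, (ε i : ℕ)) + (∑ j, (ε' j : ℕ))) * mzvCoeff (kIndex ε ε') N)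
      (fun ε _ => Finset.sum_nonneg fun ε' _ =>
        mul_nonneg (by positivity) (mzvCoeff_nonneg _ N)) (Finset.mem_univ ε)
  have hm : ∀ (ε : Fin n → Fin 2) (ε' : Fin (n - 1) → Fin 2),
      HasSum (mzvTerm (kIndex ε ε')) (∑' N, mzvCoeff (kIndex ε ε') N) := fun ε ε' =>
    (hasSum_mzvTerm_iff _ _).2 (hs ε ε').hasSum
  refine ⟨fun ε ε' => (hm ε ε').summable, ?_⟩
  rw [← eulerCoeff_six]
  refine HasSum.unique ?_ (hasSum_blockSum n)
  rw [funext hblock]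
  refine hasSum_sum fun ε _ => hasSum_sum fun ε' _ => HasSum.mul_left _ ?_
  rw [mzv, (hm ε ε').tsum_eq]
  exact (hs ε ε').hasSum
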